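/- For a non-negative integer $n$, let $\overline{B}_{2,9}(n)$ denote the number of $(2,9)$-biregular overpartitions of $n$, i.e. of partitions of $n$ in which the first occurrence of each part may be overlined and in which no part is divisible by $2$ or by $9$ (so $\overline{B}_{2,9}(0)=1$). Let $p$ be a prime with $p\equiv 5\pmod 6$. (i) For every positive integer $k$ and all non-negative integers $n$ and $r$ such that $p$ divides $6r+5$, $$\overline{B}_{2,9}\left(6p^{k+1}n+6pr+5p\right)\equiv (-p)\cdot\overline{B}_{2,9}\left(6p^{k-1}n+\frac{6r+5}{p}\right)\pmod 8.$$ (ii) For every positive integer $k$ and every non-negative integer $n$, $$\overline{B}_{2,9}\left(6p^{2k}n+p^{2k}\right)\equiv(-p)^k\,\overline{B}_{2,9}(6n+1)\pmod 8.$$ -/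

import Mathlib

/-- An overpartition of `n`: a partition of `n` in which the first occurrence of each
part size may be overlined. It is recorded as a partition of `n` together with the finite set of
those part sizes whose first occurrence is overlined. -/
@[ext]
structure Overpartition (n : ℕ) where
  /-- the underlying partition -/
  partition : n.Partition
  /-- the part sizes whose first occurrence is overlined -/
  overlined : Finset ℕ
  /-- only part sizes that occur can be overlined -/
  overlined_mem : ∀ i ∈ overlined, i ∈ partition.parts

/-- There are finitely many overpartitions of `n`, so counting them with `Nat.card` is meaningful. -/
instance Overpartition.instFinite (n : ℕ) : Finite (Overpartition n) := by
  let f : Overpartition n → n.Partition × (Finset.range (n + 1)).powerset := fun x =>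
    (x.partition, ⟨x.overlined, Finset.mem_powerset.2 fun i hi => Finset.mem_range.2
      (Nat.lt_succ_of_le (Nat.Partition.le_of_mem_parts (x.overlined_mem i hi)))⟩)
  refine Finite.of_injective f fun x y h => ?_
  have h₁ : x.partition = y.partition := congrArg Prod.fst h
  have h₂ : x.overlined = y.overlined := congrArg (fun z => (z.2 : Finset ℕ)) h
  exact Overpartition.ext h₁ h₂

/-- An overpartition is `(l₁, l₂)`-biregular if none of its parts is divisible by `l₁` or `l₂`. -/
def Overpartition.IsBiregular (l₁ l₂ : ℕ) {n : ℕ} (x : Overpartition n) : Prop :=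
  ∀ i ∈ x.partition.parts, ¬ l₁ ∣ i ∧ ¬ l₂ ∣ i

/-- The number of `(l₁, l₂)`-biregular overpartitions of `n`. -/
noncomputable def biregularOverpartitionCount (l₁ l₂ n : ℕ) : ℕ :=
  Nat.card {x : Overpartition n // x.IsBiregular l₁ l₂}

open scoped PowerSeries.WithPiTopology

/-! Both parts follow from one relation: B(p²m) ≡ -p·B(m) mod 8 whenever m ≡ 1 mod 6.
Inclusion-exclusion over 2 and 9, with Gauss's square theorem, gives the generating function
φ(-q²)φ(-q⁹)/(φ(-q)φ(-q¹⁸)), where φ(-q) = 1 + 2∑(-1)^x q^(x²) over x ≥ 1. Expanding modulo 8 and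
discarding terms by congruences modulo 2 and 3 leaves, for m ≡ 1 mod 6, B(m) ≡ 2·[m is a square] +
4·#{x, y > 0 : x² + 9y² = m}. Twice the right side is exactly r₂(m), the number of Gaussian integers
of norm m, so 2B(m) ≡ r₂(m) mod 16 (`two_mul_biregularOverpartitionCount_modEq`). If p ≡ 3 mod 4,
then p is inert and r₂(p²m) = r₂(m). If p ≡ 1 mod 4, then r₂(p²m) + r₂(m) = 2r₂(pm), and 8 ∣ r₂(pm)
because pm ≡ 5 mod 6. Hence r₂(p²m) ≡ ±r₂(m) mod 16 with the sign of -p mod 4. Since B(m) is even,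
that sign may be replaced by -p modulo 8. -/

/-- A biregular overpartition is a biregular partition together with a set of its part sizes. -/
theorem biregularOverpartitionCount_eq_sum (l₁ l₂ n : ℕ) :
    biregularOverpartitionCount l₁ l₂ n =
      ∑ p : n.Partition, if ∀ i ∈ p.parts, ¬ l₁ ∣ i ∧ ¬ l₂ ∣ i
        then 2 ^ p.parts.toFinset.card else 0 := by
  classical
  let e : {x : Overpartition n // x.IsBiregular l₁ l₂} ≃
      Σ p : {p : n.Partition // ∀ i ∈ p.parts, ¬ l₁ ∣ i ∧ ¬ l₂ ∣ i},
        {s : Finset ℕ // s ∈ p.1.parts.toFinset.powerset} :=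
    { toFun := fun x => ⟨⟨x.1.partition, x.2⟩, ⟨x.1.overlined, by
        simpa [Finset.subset_iff] using x.1.overlined_mem⟩⟩
      invFun := fun y => ⟨⟨y.1.1, y.2.1, fun i hi => by
        simpa using Finset.mem_powerset.1 y.2.2 hi⟩, y.1.2⟩
      left_inv := fun x => rfl
      right_inv := fun y => rfl }
  rw [biregularOverpartitionCount, Nat.card_congr e, Nat.card_eq_fintype_card, Fintype.card_sigma]
  simp only [Fintype.card_coe, Finset.card_powerset]
  rw [← Finset.sum_filter]
  exact (Finset.sum_subtype _ (by simp) (fun p : n.Partition => 2 ^ p.parts.toFinset.card)).symm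

/-! ### Product form of the generating function -/

/-- The generating function of the biregular overpartition numbers. -/
noncomputable def biregularSeries (l₁ l₂ : ℕ) : PowerSeries ℤ :=
  PowerSeries.mk fun n => (biregularOverpartitionCount l₁ l₂ n : ℤ)

/-- Each part size that occurs has weight 2 (overlined or not), whatever its multiplicity. -/
theorem biregularSeries_eq_genFun (l₁ l₂ : ℕ) :
    biregularSeries l₁ l₂ =
      Nat.Partition.genFun fun i _ => if ¬ l₁ ∣ i ∧ ¬ l₂ ∣ i then (2 : ℤ) else 0 := by
  ext n
  rw [biregularSeries, PowerSeries.coeff_mk, Nat.Partition.coeff_genFun,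
    biregularOverpartitionCount_eq_sum]
  push_cast
  refine Finset.sum_congr rfl fun p _ => ?_
  rw [Finsupp.prod, Multiset.toFinsupp_support]
  split_ifs with h
  · rw [Finset.prod_congr rfl (g := fun _ => (2 : ℤ)), Finset.prod_const]
    intro i hi
    rw [if_pos (h i (by simpa using hi))]
  · push Not at h
    obtain ⟨i, hi, h⟩ := h
    refine (Finset.prod_eq_zero (i := i) (by simpa using hi) ?_).symm
    rw [if_neg]
    rintro ⟨h1, h2⟩
    exact h2 (h h1)

/-- The factor at `i` of the restricted products `∏ (1 + c X ^ i)`. -/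
noncomputable def restrictedFactor (P : ℕ → Prop) [DecidablePred P] (c : ℤ) (i : ℕ) :
    PowerSeries ℤ :=
  if P (i + 1) then 1 + PowerSeries.C c * PowerSeries.X ^ (i + 1) else 1

theorem multipliable_restrictedFactor (P : ℕ → Prop) [DecidablePred P] (c : ℤ) :
    Multipliable (restrictedFactor P c) := by
  have h : restrictedFactor P c = fun i => 1 +
      (if P (i + 1) then PowerSeries.C c * PowerSeries.X ^ (i + 1) else 0) := by
    ext1 i
    unfold restrictedFactor
    split_ifs <;> simp
  rw [h]
  apply PowerSeries.WithPiTopology.multipliable_one_add_of_tendsto_order_atTop_nhds_top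
  refine ENat.tendsto_nhds_top_iff_natCast_lt.mpr fun n => Filter.eventually_atTop.mpr ⟨n, ?_⟩
  intro m hm
  split_ifs
  · grw [← PowerSeries.le_order_mul, PowerSeries.order_X_pow]
    refine lt_add_of_nonneg_of_lt (by simp) ?_
    norm_cast
    omega
  · simp

/-- The infinite product `∏ (1 + c X ^ (k i))` over `i ≥ 1`. -/
noncomputable def eulerProduct (c : ℤ) (k : ℕ) : PowerSeries ℤ :=
  ∏' i, restrictedFactor (k ∣ ·) c i

theorem hasProd_eulerProduct (c : ℤ) {k : ℕ} (hk : 0 < k) :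
    HasProd (fun i => 1 + PowerSeries.C c * (PowerSeries.X ^ k) ^ (i + 1)) (eulerProduct c k) := by
  have h := (multipliable_restrictedFactor (k ∣ ·) c).hasProd
  -- Index `i` carries the exponent `i + 1`, so the multiple `k * (i + 1)` sits at index `k * (i +
  -- 1) - 1`; all other factors are 1.
  have hinj : Function.Injective fun i => k * (i + 1) - 1 := by
    intro a b hab
    have ha : 0 < k * (a + 1) := by positivity
    have hb : 0 < k * (b + 1) := by positivity
    have : k * (a + 1) = k * (b + 1) := by simp only at hab; omega
    simpa using Nat.eq_of_mul_eq_mul_left hk this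
  rw [← hinj.hasProd_iff] at h
  · convert! h using 1
    ext1 i
    have : k * (i + 1) - 1 + 1 = k * (i + 1) := Nat.sub_add_cancel (by nlinarith)
    simp [restrictedFactor, this, pow_mul]
  · intro i hi
    refine if_neg fun ⟨j, hj⟩ => hi ⟨j - 1, ?_⟩
    have : j ≠ 0 := by rintro rfl; simp at hj
    simp only [Nat.sub_add_cancel (Nat.one_le_iff_ne_zero.2 this), ← hj, Nat.add_sub_cancel]

/-- The infinite product `∏ (1 + c X ^ i)` over the `i` divisible by neither `2` nor `9`. -/
noncomputable def coprimeProduct (c : ℤ) : PowerSeries ℤ :=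
  ∏' i, restrictedFactor (fun i => ¬ 2 ∣ i ∧ ¬ 9 ∣ i) c i

/-- Inclusion-exclusion factor by factor, with 18 = lcm(2, 9). -/
theorem coprimeProduct_mul (c : ℤ) :
    coprimeProduct c * eulerProduct c 2 * eulerProduct c 9 =
      eulerProduct c 1 * eulerProduct c 18 := by
  have hm := fun P [DecidablePred P] => multipliable_restrictedFactor P c
  unfold coprimeProduct eulerProduct
  rw [← (hm _).tprod_mul (hm _), ← ((hm _).mul (hm _)).tprod_mul (hm _),
    ← (hm _).tprod_mul (hm _)]
  congr 1
  ext1 i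
  unfold restrictedFactor
  have h18 : 18 ∣ i + 1 ↔ 2 ∣ i + 1 ∧ 9 ∣ i + 1 := by omega
  by_cases h2 : 2 ∣ i + 1 <;> by_cases h9 : 9 ∣ i + 1 <;> simp [h2, h9, h18]

/-- Each admissible size contributes 1 + 2(x + x² + ⋯) = (1 + x)/(1 - x) with x = X^i. -/
theorem biregularSeries_mul_coprimeProduct :
    biregularSeries 2 9 * coprimeProduct (-1) = coprimeProduct 1 := by
  rw [biregularSeries_eq_genFun, Nat.Partition.genFun_eq_tprod, coprimeProduct, coprimeProduct,
    ← Multipliable.tprod_mul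
      (Nat.Partition.multipliable_genFun fun i _ => if ¬ 2 ∣ i ∧ ¬ 9 ∣ i then (2 : ℤ) else 0)
      (multipliable_restrictedFactor _ _)]
  congr 1
  ext1 i
  unfold restrictedFactor
  simp only [PowerSeries.smul_eq_C_mul]
  split_ifs with h
  · have hX : PowerSeries.constantCoeff ((PowerSeries.X : PowerSeries ℤ) ^ (i + 1)) = 0 := by simp
    have hs := PowerSeries.WithPiTopology.tsum_pow_mul_one_sub_of_constantCoeff_eq_zero hX
    have hsum := PowerSeries.WithPiTopology.summable_pow_of_constantCoeff_eq_zero hX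
    have h0 : ∑' j : ℕ, PowerSeries.C (2 : ℤ) * PowerSeries.X ^ ((i + 1) * (j + 1)) =
        2 * ∑' j : ℕ, (PowerSeries.X ^ (i + 1)) ^ (j + 1) := by
      rw [← ((summable_nat_add_iff 1).2 hsum).tsum_mul_left]
      simp only [pow_mul, map_ofNat]
    rw [hsum.tsum_eq_zero_add, pow_zero] at hs
    rw [h0]
    simp only [map_neg, map_one]
    linear_combination 2 * hs
  · simp

/-! ### Gauss's square theorem -/

/-- A finite form of Gauss's square theorem. -/
theorem gauss_square_finite {R : Type*} [CommRing R] (q : R) (n : ℕ) :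
    (∏ i ∈ Finset.Icc 1 n, (1 + q ^ i)) * (1 + 2 * ∑ s ∈ Finset.Icc 1 n, (-1) ^ s * q ^ (s ^ 2)) =
      ∏ i ∈ Finset.Icc 1 n, (1 - q ^ i) +
        2 * ∑ s ∈ Finset.Icc 1 n, (-1) ^ s * q ^ (s * (n + 1)) *
          (∏ i ∈ Finset.Ico 1 s, (1 + q ^ i)) * ∏ i ∈ Finset.Ioc s n, (1 - q ^ i) := by
  induction n with
  | zero => simp
  | succ n ih =>
    have hF : ∏ i ∈ Finset.Icc 1 (n + 1), (1 + q ^ i) =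
        (∏ i ∈ Finset.Icc 1 n, (1 + q ^ i)) * (1 + q ^ (n + 1)) :=
      Finset.prod_Icc_succ_top (by omega) _
    have hG : ∏ i ∈ Finset.Icc 1 (n + 1), (1 - q ^ i) =
        (∏ i ∈ Finset.Icc 1 n, (1 - q ^ i)) * (1 - q ^ (n + 1)) :=
      Finset.prod_Icc_succ_top (by omega) _
    -- The correction sums for `n + 1` and `n` differ by a telescoping sum; the partial sums up to
    -- `m` have this closed form.
    have htel : ∀ m ≤ n,
        ∑ s ∈ Finset.Icc 1 m, ((-1) ^ s * q ^ (s * (n + 1 + 1)) *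
            (∏ i ∈ Finset.Ico 1 s, (1 + q ^ i)) * ∏ i ∈ Finset.Ioc s (n + 1), (1 - q ^ i)) -
          (1 + q ^ (n + 1)) * ∑ s ∈ Finset.Icc 1 m, (-1) ^ s * q ^ (s * (n + 1)) *
            (∏ i ∈ Finset.Ico 1 s, (1 + q ^ i)) * ∏ i ∈ Finset.Ioc s n, (1 - q ^ i) =
        q ^ (n + 1) * ∏ i ∈ Finset.Icc 1 n, (1 - q ^ i) -
          (-1) ^ m * q ^ ((m + 1) * (n + 1)) * (∏ i ∈ Finset.Icc 1 m, (1 + q ^ i)) *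
            ∏ i ∈ Finset.Ioc m n, (1 - q ^ i) := by
      intro m
      induction m with
      | zero => intro _; simp [← Finset.Icc_add_one_left_eq_Ioc]
      | succ m ihm =>
        intro hm
        have h := ihm (by omega)
        rw [Finset.sum_Icc_succ_top (by omega), Finset.sum_Icc_succ_top (by omega),
          Finset.prod_Icc_succ_top (by omega)]
        have h1 : ∏ i ∈ Finset.Ioc (m + 1) (n + 1), (1 - q ^ i) =
            (∏ i ∈ Finset.Ioc (m + 1) n, (1 - q ^ i)) * (1 - q ^ (n + 1)) :=
          Finset.prod_Ioc_succ_top (by omega) _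
        have h2 : ∏ i ∈ Finset.Ioc m n, (1 - q ^ i) =
            (1 - q ^ (m + 1)) * ∏ i ∈ Finset.Ioc (m + 1) n, (1 - q ^ i) := by
          rw [← Finset.Icc_add_one_left_eq_Ioc, ← Finset.Icc_add_one_left_eq_Ioc,
            Finset.Icc_eq_cons_Ioc (by omega), Finset.prod_cons,
            ← Finset.Icc_add_one_left_eq_Ioc]
        have h3 : Finset.Ico 1 (m + 1) = Finset.Icc 1 m := rfl
        rw [h2] at h
        rw [h1, h3]
        linear_combination (exp := 1) h
    have h := htel n le_rfl
    rw [hF, hG, Finset.sum_Icc_succ_top (by omega), Finset.sum_Icc_succ_top (by omega)]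
    have h3 : Finset.Ico 1 (n + 1) = Finset.Icc 1 n := rfl
    rw [h3]
    simp only [Finset.Ioc_self, Finset.prod_empty, mul_one] at h ⊢
    linear_combination (1 + q ^ (n + 1)) * ih - 2 * h

/-- The series `∑ (-1) ^ x X ^ (k x²)` over `x ≥ 1`. -/
noncomputable def halfTheta (k : ℕ) : PowerSeries ℤ :=
  PowerSeries.mk fun n => ∑ x ∈ Finset.Icc 1 n, if n = k * x ^ 2 then (-1) ^ x else 0

theorem coeff_halfTheta_eq_coeff_sum {k : ℕ} (hk : 0 < k) {n N : ℕ} (h : n ≤ N) :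
    (halfTheta k).coeff n =
      (∑ x ∈ Finset.Icc 1 N, (-1) ^ x * (PowerSeries.X : PowerSeries ℤ) ^ (k * x ^ 2)).coeff n := by
  have h1 : ∀ x : ℕ, (-1 : PowerSeries ℤ) ^ x = PowerSeries.C ((-1) ^ x) := by simp
  simp only [halfTheta, PowerSeries.coeff_mk, map_sum, h1, PowerSeries.coeff_C_mul,
    PowerSeries.coeff_X_pow, mul_ite, mul_one, mul_zero]
  refine Finset.sum_subset (Finset.Icc_subset_Icc_right h) fun x hx hx' => if_neg ?_
  simp only [Finset.mem_Icc, not_and, not_le] at hx hx'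
  have := hx' hx.1
  nlinarith

theorem tendsto_halfTheta {k : ℕ} (hk : 0 < k) :
    Filter.Tendsto (fun N => ∑ x ∈ Finset.Icc 1 N,
      (-1) ^ x * (PowerSeries.X : PowerSeries ℤ) ^ (k * x ^ 2)) Filter.atTop
      (nhds (halfTheta k)) := by
  rw [PowerSeries.WithPiTopology.tendsto_iff_coeff_tendsto]
  intro n
  exact tendsto_atTop_of_eventually_const (i₀ := n) fun N hN =>
    (coeff_halfTheta_eq_coeff_sum hk hN).symm

theorem tendsto_eulerProduct (c : ℤ) {k : ℕ} (hk : 0 < k) :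
    Filter.Tendsto (fun N => ∏ i ∈ Finset.Icc 1 N,
      (1 + PowerSeries.C c * (PowerSeries.X ^ k) ^ i)) Filter.atTop
      (nhds (eulerProduct c k)) := by
  convert! (hasProd_eulerProduct c hk).tendsto_prod_nat using 2 with N
  rw [Finset.range_eq_Ico, Finset.prod_Ico_add' (fun i => 1 + PowerSeries.C c *
    ((PowerSeries.X : PowerSeries ℤ) ^ k) ^ i) 0 N 1]
  congr 1

/-- **Gauss's square theorem**. -/
theorem eulerProduct_one_mul {k : ℕ} (hk : 0 < k) :
    eulerProduct 1 k * (1 + 2 * halfTheta k) = eulerProduct (-1) k := by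
  have h := ((tendsto_eulerProduct 1 hk).mul
    (((tendsto_halfTheta hk).const_mul 2).const_add 1)).sub (tendsto_eulerProduct (-1) hk)
  refine sub_eq_zero.1 (tendsto_nhds_unique h ?_)
  rw [PowerSeries.WithPiTopology.tendsto_iff_coeff_tendsto]
  intro n
  refine tendsto_atTop_of_eventually_const (i₀ := n) fun N hN => ?_
  have hg := gauss_square_finite ((PowerSeries.X : PowerSeries ℤ) ^ k) N
  simp only [map_one, map_neg, one_mul, neg_mul, ← sub_eq_add_neg, pow_mul] at hg ⊢
  rw [hg, add_sub_cancel_left, map_zero]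
  refine PowerSeries.X_pow_dvd_iff.1 ?_ n (Nat.lt_succ_of_le hN)
  refine Dvd.dvd.mul_left (Finset.dvd_sum fun s hs => ?_) _
  -- Every correction term of the finite identity is divisible by X^(N+1), so it cannot affect the
  -- coefficient at n ≤ N.
  have hle : N + 1 ≤ k * (s * (N + 1)) := by
    have : 1 ≤ s := (Finset.mem_Icc.1 hs).1
    calc N + 1 = 1 * (1 * (N + 1)) := by ring
      _ ≤ k * (s * (N + 1)) := by gcongr; omega
  have hdvd := pow_dvd_pow (PowerSeries.X : PowerSeries ℤ) hle
  rw [pow_mul, pow_mul] at hdvd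
  exact ((hdvd.mul_left _).mul_right _).mul_right _

theorem eulerProduct_ne_zero (c : ℤ) {k : ℕ} (hk : 0 < k) : eulerProduct c k ≠ 0 := by
  have h := ((PowerSeries.WithPiTopology.continuous_constantCoeff ℤ).tendsto _).comp
    (tendsto_eulerProduct c hk)
  have h1 : PowerSeries.constantCoeff (eulerProduct c k) = 1 := by
    refine tendsto_nhds_unique h (tendsto_atTop_of_eventually_const (i₀ := 0) fun N _ => ?_)
    simp only [Function.comp, map_prod]
    refine Finset.prod_eq_one fun i hi => ?_
    have : i ≠ 0 := by have := (Finset.mem_Icc.1 hi).1; omega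
    simp [hk.ne', this]
  intro h0
  simp [h0] at h1

/-! ### The theta quotient modulo 8 -/

theorem biregularSeries_mul_theta :
    biregularSeries 2 9 * (1 + 2 * halfTheta 1) * (1 + 2 * halfTheta 18) =
      (1 + 2 * halfTheta 2) * (1 + 2 * halfTheta 9) := by
  have g1 := eulerProduct_one_mul (k := 1) (by norm_num)
  have g2 := eulerProduct_one_mul (k := 2) (by norm_num)
  have g9 := eulerProduct_one_mul (k := 9) (by norm_num)
  have g18 := eulerProduct_one_mul (k := 18) (by norm_num)
  have hp := coprimeProduct_mul 1
  have hm := coprimeProduct_mul (-1)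
  have hb := biregularSeries_mul_coprimeProduct
  rw [← g1, ← g2, ← g9, ← g18] at hm
  have n1 := eulerProduct_ne_zero 1 (k := 1) (by norm_num)
  have n2 := eulerProduct_ne_zero 1 (k := 2) (by norm_num)
  have n9 := eulerProduct_ne_zero 1 (k := 9) (by norm_num)
  have n18 := eulerProduct_ne_zero 1 (k := 18) (by norm_num)
  refine mul_left_cancel₀ (mul_ne_zero n1 n18) ?_
  calc _ = biregularSeries 2 9 * (eulerProduct 1 1 * (1 + 2 * halfTheta 1) *
        (eulerProduct 1 18 * (1 + 2 * halfTheta 18))) := by ring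
    _ = (biregularSeries 2 9 * coprimeProduct (-1)) * eulerProduct 1 2 * eulerProduct 1 9 *
        ((1 + 2 * halfTheta 2) * (1 + 2 * halfTheta 9)) := by rw [← hm]; ring
    _ = _ := by rw [hb, hp]

/-- The expansion of the generating function modulo `8`. -/
theorem biregularSeries_expansion : ∃ Z : PowerSeries ℤ,
    biregularSeries 2 9 =
      1 + 2 * (halfTheta 2 + halfTheta 9 - halfTheta 1 - halfTheta 18) +
        4 * (halfTheta 1 * halfTheta 1 + halfTheta 18 * halfTheta 18 +
          halfTheta 2 * halfTheta 9 + halfTheta 1 * halfTheta 18 - halfTheta 1 * halfTheta 2 -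
          halfTheta 2 * halfTheta 18 - halfTheta 1 * halfTheta 9 - halfTheta 9 * halfTheta 18) +
        8 * Z := by
  have h := biregularSeries_mul_theta
  generalize biregularSeries 2 9 = B, halfTheta 1 = a, halfTheta 2 = b, halfTheta 9 = c,
    halfTheta 18 = d at h ⊢
  have e : ∀ x : PowerSeries ℤ, (1 + 2 * x) * (1 - 2 * x + 4 * x ^ 2) = 1 + 8 * x ^ 3 :=
    fun x => by ring
  -- Since (1 + 2x)(1 - 2x + 4x²) = 1 + 8x³, the factor 1 - 2x + 4x² inverts 1 + 2x modulo 8. The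
  -- witness collects the multiples of 8; its last term, containing `B`, comes from (1 + 8a³)(1 +
  -- 8d³).
  refine ⟨(b * c * (-a - d) + (b + c) * (a ^ 2 + d ^ 2 + a * d) - a * d * (a + d)) +
    2 * (b * c * (a ^ 2 + a * d + d ^ 2) - (b + c) * a * d * (a + d) + a ^ 2 * d ^ 2) +
    4 * ((b + c) * a ^ 2 * d ^ 2 - b * c * a * d * (a + d)) + 8 * (b * c * a ^ 2 * d ^ 2) -
    B * (a ^ 3 + d ^ 3 + 8 * a ^ 3 * d ^ 3), ?_⟩
  linear_combination (1 - 2 * a + 4 * a ^ 2) * (1 - 2 * d + 4 * d ^ 2) * h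

/-! ### Coefficients at m ≡ 1 mod 6 -/

/-- The number of pairs of positive `x`, `y` with `j x² + k y² = m`. -/
def positiveReps (j k m : ℕ) : ℤ :=
  ∑ x ∈ Finset.Icc 1 m, ∑ y ∈ Finset.Icc 1 m, if j * x ^ 2 + k * y ^ 2 = m then 1 else 0

/-- The indicator of the positive squares. -/
def squareIndicator (m : ℕ) : ℤ :=
  ∑ x ∈ Finset.Icc 1 m, if x ^ 2 = m then 1 else 0

theorem PowerSeries.coeff_mul_congr {R : Type*} [Semiring R] {f f' g g' : PowerSeries R} {m : ℕ}
    (hf : ∀ n ≤ m, f.coeff n = f'.coeff n) (hg : ∀ n ≤ m, g.coeff n = g'.coeff n) :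
    (f * g).coeff m = (f' * g').coeff m := by
  rw [PowerSeries.coeff_mul, PowerSeries.coeff_mul]
  refine Finset.sum_congr rfl fun x hx => ?_
  have := Finset.HasAntidiagonal.mem_antidiagonal.1 hx
  rw [hf _ (by omega), hg _ (by omega)]

/-- The signs disappear modulo 2, which suffices because these products enter with coefficient 4. -/
theorem coeff_halfTheta_mul {j k : ℕ} (hj : 0 < j) (hk : 0 < k) (m : ℕ) :
    (halfTheta j * halfTheta k).coeff m ≡ positiveReps j k m [ZMOD 2] := by
  have h1 : ∀ x : ℕ, (-1 : PowerSeries ℤ) ^ x = PowerSeries.C ((-1) ^ x) := by simp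
  rw [PowerSeries.coeff_mul_congr (fun n hn => coeff_halfTheta_eq_coeff_sum hj hn)
    (fun n hn => coeff_halfTheta_eq_coeff_sum hk hn), Finset.sum_mul_sum, map_sum, positiveReps]
  refine Int.ModEq.sum fun x _ => ?_
  rw [map_sum]
  refine Int.ModEq.sum fun y _ => ?_
  have h2 : (-1) ^ x * (PowerSeries.X : PowerSeries ℤ) ^ (j * x ^ 2) *
      ((-1) ^ y * PowerSeries.X ^ (k * y ^ 2)) =
      PowerSeries.C ((-1) ^ (x + y)) * PowerSeries.X ^ (j * x ^ 2 + k * y ^ 2) := by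
    rw [← h1]; ring
  rw [h2, PowerSeries.coeff_C_mul, PowerSeries.coeff_X_pow]
  by_cases h : j * x ^ 2 + k * y ^ 2 = m
  · rw [if_pos h.symm, if_pos h, mul_one]
    rcases neg_one_pow_eq_or ℤ (x + y) with h | h <;> rw [h]
    decide
  · rw [if_neg (Ne.symm h), if_neg h, mul_zero]

theorem positiveReps_eq_zero {j k m : ℕ} (h : ∀ x y : ℕ, j * x ^ 2 + k * y ^ 2 ≠ m) :
    positiveReps j k m = 0 :=
  Finset.sum_eq_zero fun x _ => Finset.sum_eq_zero fun y _ => if_neg (h x y)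

theorem Nat.sq_mod_three_cases (x : ℕ) :
    3 ∣ x ∧ x ^ 2 % 3 = 0 ∨ ¬ 3 ∣ x ∧ x ^ 2 % 3 = 1 := by
  have : x % 3 < 3 := Nat.mod_lt _ (by norm_num)
  rw [Nat.pow_mod, Nat.dvd_iff_mod_eq_zero]
  interval_cases x % 3 <;> simp

theorem Nat.sq_mod_two_cases (x : ℕ) :
    2 ∣ x ∧ x ^ 2 % 2 = 0 ∨ ¬ 2 ∣ x ∧ x ^ 2 % 2 = 1 := by
  have : x % 2 < 2 := Nat.mod_lt _ (by norm_num)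
  rw [Nat.pow_mod, Nat.dvd_iff_mod_eq_zero]
  interval_cases x % 2 <;> simp

/-- A sum over the multiples of `d` in an interval. -/
theorem Finset.sum_Icc_ite_dvd {d : ℕ} (hd : 0 < d) (m : ℕ) (f : ℕ → ℤ)
    (hf : ∀ y, m < y → f y = 0) :
    ∑ y ∈ Finset.Icc 1 m, (if d ∣ y then f y else 0) = ∑ y ∈ Finset.Icc 1 m, f (d * y) := by
  rw [← Finset.sum_filter]
  symm
  refine Finset.sum_bij_ne_zero (fun y _ _ => d * y) ?_ ?_ ?_ ?_
  · intro y hy h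
    have h1 : d * y ≤ m := by
      by_contra hlt
      exact h (hf _ (by omega))
    have h2 : 0 < d * y := Nat.mul_pos hd (Finset.mem_Icc.1 hy).1
    simp [h1, Nat.succ_le_of_lt h2]
  · intro a _ _ b _ _ h
    exact Nat.eq_of_mul_eq_mul_left hd h
  · intro y hy h
    simp only [Finset.mem_filter, Finset.mem_Icc] at hy
    obtain ⟨⟨h1, h2⟩, z, rfl⟩ := hy
    refine ⟨z, Finset.mem_Icc.2 ⟨?_, ?_⟩, h, rfl⟩
    · exact Nat.pos_of_mul_pos_left h1
    · nlinarith
  · intros; rfl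

/-- If `d` must divide the second variable, it can be absorbed in the form. -/
theorem sum_ite_dvd_eq_positiveReps (j : ℕ) {d k : ℕ} (hd : 0 < d) (hk : 0 < k) (m : ℕ) :
    ∑ x ∈ Finset.Icc 1 m, ∑ y ∈ Finset.Icc 1 m,
      (if d ∣ y then (if j * x ^ 2 + k * y ^ 2 = m then 1 else 0) else 0) =
      positiveReps j (k * d ^ 2) m := by
  refine Finset.sum_congr rfl fun x _ => ?_
  rw [Finset.sum_Icc_ite_dvd hd m (fun y => if j * x ^ 2 + k * y ^ 2 = m then (1 : ℤ) else 0)]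
  · simp only [mul_pow, mul_assoc]
  · intro y hy
    refine if_neg fun h => ?_
    have : y ≤ k * y ^ 2 := by nlinarith
    omega

/-- If exactly one variable is divisible by `d` in any representation of `m` as a sum of two
squares, then the number of such representations is twice the number with `d` dividing the
second variable. -/
theorem positiveReps_one_one {d m : ℕ} (hd : 0 < d)
    (h : ∀ x y : ℕ, x ^ 2 + y ^ 2 = m → (d ∣ x ↔ ¬ d ∣ y)) :
    positiveReps 1 1 m = 2 * positiveReps 1 (d ^ 2) m := by
  have h1 := sum_ite_dvd_eq_positiveReps 1 hd one_pos m
  rw [one_mul] at h1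
  have h2 := h1
  rw [Finset.sum_comm] at h2
  rw [two_mul]
  nth_rewrite 1 [← h2]
  rw [← h1, ← Finset.sum_add_distrib, positiveReps]
  refine Finset.sum_congr rfl fun x _ => ?_
  rw [← Finset.sum_add_distrib]
  refine Finset.sum_congr rfl fun y _ => ?_
  simp only [one_mul, add_comm (y ^ 2)]
  by_cases hm : x ^ 2 + y ^ 2 = m
  · have := h x y hm
    by_cases hy : d ∣ y <;> simp_all
  · simp [hm]

/-- If 3 ∤ y, then x² ≡ 1 - 2 ≡ 2 mod 3, which is impossible; so y = 3y' and 2y² = 18y'². -/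
theorem positiveReps_one_two {m : ℕ} (hm : m % 3 = 1) :
    positiveReps 1 2 m = positiveReps 1 18 m := by
  rw [show 18 = 2 * 3 ^ 2 by norm_num,
    ← sum_ite_dvd_eq_positiveReps 1 (d := 3) (k := 2) (by norm_num) (by norm_num) m, positiveReps]
  refine Finset.sum_congr rfl fun x _ => Finset.sum_congr rfl fun y _ => ?_
  by_cases hy : 3 ∣ y
  · rw [if_pos hy]
  · rw [if_neg hy]
    refine if_neg fun h => ?_
    have := Nat.sq_mod_three_cases x
    have := Nat.sq_mod_three_cases y
    omega

theorem dvd_three_iff_of_add_sq {m : ℕ} (hm : m % 3 = 1) (x y : ℕ) (h : x ^ 2 + y ^ 2 = m) :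
    3 ∣ x ↔ ¬ 3 ∣ y := by
  have := Nat.sq_mod_three_cases x
  have := Nat.sq_mod_three_cases y
  omega

theorem coeff_halfTheta_eq_zero {k n : ℕ} (h : ¬ k ∣ n) : (halfTheta k).coeff n = 0 := by
  rw [halfTheta, PowerSeries.coeff_mk]
  exact Finset.sum_eq_zero fun x _ => if_neg fun e => h ⟨x ^ 2, e⟩

theorem coeff_halfTheta_one {n : ℕ} (h : ¬ 2 ∣ n) :
    (halfTheta 1).coeff n = -squareIndicator n := by
  rw [halfTheta, PowerSeries.coeff_mk, squareIndicator, ← Finset.sum_neg_distrib]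
  refine Finset.sum_congr rfl fun x _ => ?_
  by_cases hx : x ^ 2 = n
  · have hodd : Odd x := by
      rcases Nat.sq_mod_two_cases x with h2 | h2
      · omega
      · exact Nat.not_even_iff_odd.1 fun he => h2.1 he.two_dvd
    rw [if_pos (by omega), if_pos hx, hodd.neg_one_pow]
  · rw [if_neg (by omega), if_neg hx, neg_zero]

/-- Of the linear terms only `halfTheta 1` survives. Among the products, (18,18), (2,9), (2,18) and
(9,18) vanish by congruences, (1,1) is even, and (1,2) cancels (1,18); only (1,9) remains. -/
theorem biregularOverpartitionCount_modEq {m : ℕ} (hm : m % 6 = 1) :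
    (biregularOverpartitionCount 2 9 m : ℤ) ≡
      2 * squareIndicator m + 4 * positiveReps 1 9 m [ZMOD 8] := by
  obtain ⟨Z, hZ⟩ := biregularSeries_expansion
  have h := congrArg (PowerSeries.coeff m) hZ
  have hC : ∀ (c : ℤ) (f : PowerSeries ℤ),
      (PowerSeries.C c * f).coeff m = c * f.coeff m := fun c f => PowerSeries.coeff_C_mul m f c
  have e2 : (2 : PowerSeries ℤ) = PowerSeries.C 2 := by simp
  have e4 : (4 : PowerSeries ℤ) = PowerSeries.C 4 := by simp
  have e8 : (8 : PowerSeries ℤ) = PowerSeries.C 8 := by simp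
  rw [e2, e4, e8] at h
  simp only [map_add, map_sub, hC, PowerSeries.coeff_one, if_neg (show m ≠ 0 by omega)] at h
  rw [coeff_halfTheta_eq_zero (k := 2) (by omega), coeff_halfTheta_eq_zero (k := 9) (by omega),
    coeff_halfTheta_eq_zero (k := 18) (by omega), coeff_halfTheta_one (by omega),
    biregularSeries, PowerSeries.coeff_mk] at h
  have hx3 := Nat.sq_mod_three_cases
  have c11 := coeff_halfTheta_mul one_pos one_pos m
  have cDD := coeff_halfTheta_mul (j := 18) (k := 18) (by norm_num) (by norm_num) m
  have c29 := coeff_halfTheta_mul (j := 2) (k := 9) (by norm_num) (by norm_num) m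
  have c1D := coeff_halfTheta_mul (j := 1) (k := 18) (by norm_num) (by norm_num) m
  have c12 := coeff_halfTheta_mul (j := 1) (k := 2) (by norm_num) (by norm_num) m
  have c2D := coeff_halfTheta_mul (j := 2) (k := 18) (by norm_num) (by norm_num) m
  have c19 := coeff_halfTheta_mul (j := 1) (k := 9) (by norm_num) (by norm_num) m
  have c9D := coeff_halfTheta_mul (j := 9) (k := 18) (by norm_num) (by norm_num) m
  rw [positiveReps_one_one (d := 3) (by norm_num) (dvd_three_iff_of_add_sq (by omega))] at c11
  rw [positiveReps_eq_zero fun x y => by omega] at cDD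
  rw [positiveReps_eq_zero fun x y => by have := hx3 x; omega] at c29
  rw [positiveReps_eq_zero fun x y => by omega] at c2D
  rw [positiveReps_eq_zero fun x y => by omega] at c9D
  rw [positiveReps_one_two (by omega)] at c12
  rw [h]
  simp only [Int.ModEq] at *
  omega

/-! ### Comparison with sums of two squares -/

/-- The number of Gaussian integers of norm `m`. -/
noncomputable def sumTwoSquaresCount (m : ℕ) : ℕ := Set.ncard {z : GaussianInt | z.norm = m}

theorem gaussianNorm_eq (z : GaussianInt) : z.norm = z.re ^ 2 + z.im ^ 2 := by
  rw [Zsqrtd.norm_def]; ring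

theorem gaussian_finite (m : ℕ) : {z : GaussianInt | z.norm = m}.Finite := by
  refine ((Set.finite_Icc (-(m : ℤ)) m).prod (Set.finite_Icc (-(m : ℤ)) m)).preimage
    (f := fun z : GaussianInt => (z.re, z.im)) ?_ |>.subset ?_
  · intro z _ w _ h
    exact Zsqrtd.ext (congrArg Prod.fst h) (congrArg Prod.snd h)
  · intro z hz
    rw [Set.mem_ofPred_eq, gaussianNorm_eq] at hz
    have := Int.le_self_sq z.re
    have := Int.le_self_sq (-z.re)
    have := Int.le_self_sq z.im
    have := Int.le_self_sq (-z.im)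
    have := sq_nonneg z.re
    have := sq_nonneg z.im
    simp only [Set.mem_preimage, Set.mem_prod, Set.mem_Icc]
    rw [neg_sq] at *
    omega

theorem sum_Icc_neg_of_even (f : ℤ → ℤ) (hf : ∀ x, f (-x) = f x) (m : ℕ) :
    ∑ x ∈ Finset.Icc (-(m : ℤ)) m, f x = f 0 + 2 * ∑ x ∈ Finset.Icc 1 m, f x := by
  induction m with
  | zero => simp
  | succ m ih =>
    have h : Finset.Icc (-((m + 1 : ℕ) : ℤ)) (m + 1 : ℕ) =
        insert (-((m + 1 : ℕ) : ℤ)) (insert ((m + 1 : ℕ) : ℤ) (Finset.Icc (-(m : ℤ)) m)) := by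
      ext x
      simp only [Finset.mem_Icc, Finset.mem_insert]
      omega
    rw [h, Finset.sum_insert (by simp; omega), Finset.sum_insert (by simp), ih,
      Finset.sum_Icc_succ_top (by omega), hf]
    ring

theorem sumTwoSquaresCount_eq {m : ℕ} (hm : 0 < m) :
    (sumTwoSquaresCount m : ℤ) = 4 * squareIndicator m + 4 * positiveReps 1 1 m := by
  have h1 : sumTwoSquaresCount m =
      ((Finset.Icc (-(m : ℤ)) m ×ˢ Finset.Icc (-(m : ℤ)) m).filter
        fun x => x.1 ^ 2 + x.2 ^ 2 = (m : ℤ)).card := by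
    rw [sumTwoSquaresCount, ← Set.ncard_coe_finset]
    refine Set.ncard_congr (fun z _ => (z.re, z.im)) ?_ ?_ ?_
    · intro z hz
      rw [Set.mem_ofPred_eq, gaussianNorm_eq] at hz
      have := Int.le_self_sq z.re
      have := Int.le_self_sq (-z.re)
      have := Int.le_self_sq z.im
      have := Int.le_self_sq (-z.im)
      have := sq_nonneg z.re
      have := sq_nonneg z.im
      rw [neg_sq] at *
      simp only [Finset.coe_filter, Finset.mem_product, Finset.mem_Icc, Set.mem_ofPred_eq]
      omega
    · intro z w _ _ h
      exact Zsqrtd.ext (congrArg Prod.fst h) (congrArg Prod.snd h)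
    · intro x hx
      refine ⟨⟨x.1, x.2⟩, ?_, rfl⟩
      rw [Set.mem_ofPred_eq, gaussianNorm_eq]
      simpa using (Finset.mem_filter.1 hx).2
  have h2 : ∀ x : ℤ, (∑ y ∈ Finset.Icc (-(m : ℤ)) m, if x ^ 2 + y ^ 2 = m then (1 : ℤ) else 0) =
      (if x ^ 2 = m then 1 else 0) +
        2 * ∑ y ∈ Finset.Icc 1 m, if x ^ 2 + (y : ℤ) ^ 2 = m then (1 : ℤ) else 0 := by
    intro x
    rw [sum_Icc_neg_of_even (fun y => if x ^ 2 + y ^ 2 = m then (1 : ℤ) else 0)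
      (fun y => by simp only [neg_sq])]
    simp
  have h3 : ∀ x : ℕ, ((x : ℤ) ^ 2 = m ↔ x ^ 2 = m) := fun x => by norm_cast
  have h4 : ∀ x y : ℕ, ((x : ℤ) ^ 2 + (y : ℤ) ^ 2 = m ↔ x ^ 2 + y ^ 2 = m) :=
    fun x y => by norm_cast
  rw [h1, Finset.card_filter]
  push_cast
  rw [Finset.sum_product]
  simp only [h2]
  rw [sum_Icc_neg_of_even _ (fun x => by simp only [neg_sq])]
  have h0 : (0 : ℤ) ≠ m := by exact_mod_cast hm.ne
  simp only [ne_eq, OfNat.ofNat_ne_zero, not_false_eq_true, zero_pow, zero_add, if_neg h0, h3, h4,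
    Finset.sum_add_distrib, ← Finset.mul_sum, positiveReps, squareIndicator, one_mul]
  ring

theorem sumTwoSquaresCount_of_mod_three {m : ℕ} (hm : m % 3 = 1) :
    (sumTwoSquaresCount m : ℤ) = 4 * squareIndicator m + 8 * positiveReps 1 9 m := by
  rw [sumTwoSquaresCount_eq (by omega),
    positiveReps_one_one (d := 3) (by norm_num) (dvd_three_iff_of_add_sq hm)]
  norm_num
  ring

/-- As m ≡ 2 mod 3 is not a square, no representation lies on an axis; as m is odd, exactly one
variable is even, which gives a factor 2 besides the four signs. -/
theorem eight_dvd_sumTwoSquaresCount {m : ℕ} (hm : m % 6 = 5) : 8 ∣ sumTwoSquaresCount m := by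
  have h : (sumTwoSquaresCount m : ℤ) = 8 * positiveReps 1 4 m := by
    rw [sumTwoSquaresCount_eq (by omega), positiveReps_one_one (d := 2) (by norm_num)]
    · have : squareIndicator m = 0 := Finset.sum_eq_zero fun x _ => if_neg fun h => by
        have := Nat.sq_mod_three_cases x
        omega
      rw [this]
      norm_num
      ring
    · intro x y h
      have := Nat.sq_mod_two_cases x
      have := Nat.sq_mod_two_cases y
      omega
  have : (8 : ℤ) ∣ (sumTwoSquaresCount m : ℤ) := ⟨_, h⟩
  exact_mod_cast this

theorem two_mul_biregularOverpartitionCount_modEq {m : ℕ} (hm : m % 6 = 1) :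
    2 * (biregularOverpartitionCount 2 9 m : ℤ) ≡ sumTwoSquaresCount m [ZMOD 16] := by
  have h1 := biregularOverpartitionCount_modEq hm
  rw [sumTwoSquaresCount_of_mod_three (by omega)]
  simp only [Int.ModEq] at *
  omega

theorem two_dvd_biregularOverpartitionCount {m : ℕ} (hm : m % 6 = 1) :
    (2 : ℤ) ∣ biregularOverpartitionCount 2 9 m := by
  have h1 := biregularOverpartitionCount_modEq hm
  simp only [Int.ModEq] at *
  omega

/-! ### Multiplication of the norm by p² -/

/-- A prime `p ≡ 3 mod 4` is inert in the Gaussian integers. -/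
theorem sumTwoSquaresCount_sq_mul_of_inert {p : ℕ} (hp : p.Prime) (h3 : p % 4 = 3) (m : ℕ) :
    sumTwoSquaresCount (p ^ 2 * m) = sumTwoSquaresCount m := by
  have := Fact.mk hp
  have hprime : Prime (p : GaussianInt) := GaussianInt.prime_of_nat_prime_of_mod_four_eq_three p h3
  have hp0 : (p : ℤ) ≠ 0 := by exact_mod_cast hp.ne_zero
  rw [sumTwoSquaresCount, sumTwoSquaresCount]
  symm
  refine Set.ncard_congr (fun z _ => (p : GaussianInt) * z) ?_ ?_ ?_
  · intro z hz
    simp only [Set.mem_ofPred_eq] at *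
    rw [Zsqrtd.norm_mul, hz, Zsqrtd.norm_natCast]
    push_cast; ring
  · intro z w _ _ h
    exact mul_left_cancel₀ hprime.ne_zero h
  · intro w hw
    have hnorm : (p : GaussianInt) ∣ w * star w := by
      rw [← Zsqrtd.norm_eq_mul_conj, hw]
      exact ⟨p * m, by push_cast; ring⟩
    have hdvd : (p : GaussianInt) ∣ w := by
      rcases hprime.dvd_or_dvd hnorm with h | ⟨v, hv⟩
      · exact h
      · refine ⟨star v, ?_⟩
        have := congrArg star hv
        simpa [mul_comm] using this
    obtain ⟨z, rfl⟩ := hdvd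
    refine ⟨z, ?_, rfl⟩
    simp only [Set.mem_ofPred_eq, Zsqrtd.norm_mul, Zsqrtd.norm_natCast] at *
    push_cast at hw
    exact mul_left_cancel₀ (mul_ne_zero hp0 hp0) (by linear_combination hw)

/-- The Hecke relation at a prime that splits in the Gaussian integers. -/
theorem sumTwoSquaresCount_sq_mul_of_split {p : ℕ} (hp : p.Prime) (h1 : p % 4 = 1) (m : ℕ) :
    sumTwoSquaresCount (p ^ 2 * m) + sumTwoSquaresCount m = 2 * sumTwoSquaresCount (p * m) := by
  have := Fact.mk hp
  obtain ⟨a, b, hab⟩ := Nat.Prime.sq_add_sq (p := p) (by omega)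
  have habz : (a : ℤ) ^ 2 + (b : ℤ) ^ 2 = p := by exact_mod_cast hab
  have hp0 : (p : ℤ) ≠ 0 := by exact_mod_cast hp.ne_zero
  let π : GaussianInt := ⟨a, b⟩
  have hπn : π.norm = p := by rw [gaussianNorm_eq]; exact habz
  have hπ'n : (star π).norm = p := by rw [Zsqrtd.norm_conj, hπn]
  have hππ : π * star π = p := by
    rw [← Zsqrtd.norm_eq_mul_conj, hπn]; simp
  have hprime : ∀ w : GaussianInt, w.norm = p → Prime w := by
    intro w hw
    refine Irreducible.prime ⟨fun hu => ?_, fun x y hxy => ?_⟩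
    · have := Zsqrtd.norm_eq_one_iff.2 hu
      rw [hw] at this
      simp only [Int.natAbs_natCast] at this
      exact hp.one_lt.ne' this
    · have := congrArg (fun z => (Zsqrtd.norm z).natAbs) hxy
      simp only [hw, Zsqrtd.norm_mul, Int.natAbs_mul, Int.natAbs_natCast] at this
      rw [← Zsqrtd.norm_eq_one_iff, ← Zsqrtd.norm_eq_one_iff]
      have h := hp.eq_one_or_self_of_dvd _ (Dvd.intro _ this.symm)
      rcases h with h | h
      · exact Or.inl h
      · right
        rw [h] at this
        exact Nat.eq_of_mul_eq_mul_left hp.pos (by omega)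
  have hπ := hprime π hπn
  have hπ' := hprime (star π) hπ'n
  -- Otherwise π divides π + star π = 2a; taking norms, p ∣ 4a², so p ∣ a, contradicting a² + b² =
  -- p.
  have hndvd : ¬ π ∣ star π := by
    intro h
    have h2 : π ∣ ((2 * a : ℤ) : GaussianInt) := by
      have : ((2 * a : ℤ) : GaussianInt) = π + star π := by
        ext <;> simp [π]; ring
      rw [this]
      exact dvd_add dvd_rfl h
    have h3 := map_dvd Zsqrtd.normMonoidHom h2
    have h4 : (p : ℤ) ∣ (2 * a) * (2 * a) := by
      have e : Zsqrtd.normMonoidHom (((2 * a : ℤ) : GaussianInt)) = (2 * a) * (2 * a) :=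
        Zsqrtd.norm_intCast _
      rw [e] at h3
      rw [← hπn]
      exact h3
    have h5 : (p : ℤ) ∣ 2 * a := by
      rcases (Nat.prime_iff_prime_int.1 hp).dvd_or_dvd h4 with h | h <;> exact h
    have h6 : p ∣ 2 * a := by exact_mod_cast h5
    have h7 : p ∣ a := by
      rcases hp.dvd_mul.1 h6 with h | h
      · have := Nat.le_of_dvd (by norm_num) h
        have := hp.two_le
        omega
      · exact h
    have ha : a ≠ 0 := by
      rintro rfl
      have : Nat.Prime (b ^ 2) := by
        have e : b ^ 2 = p := by omega
        rwa [e]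
      exact Nat.Prime.not_prime_pow le_rfl this
    have := Nat.le_of_dvd (Nat.pos_of_ne_zero ha) h7
    have := hp.two_le
    nlinarith
  have hinj : ∀ w : GaussianInt, Prime w → Function.Injective (w * ·) :=
    fun w hw _ _ h => mul_left_cancel₀ hw.ne_zero h
  -- Every element of norm p²m is divisible by π or by its conjugate; those divisible by both are
  -- the multiples of p. Counting union and intersection gives the relation.
  have hA : (π * ·) '' {z : GaussianInt | z.norm = (p * m : ℕ)} ∪
      (star π * ·) '' {z : GaussianInt | z.norm = (p * m : ℕ)} =
      {z : GaussianInt | z.norm = (p ^ 2 * m : ℕ)} := by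
    ext w
    constructor
    · rintro (⟨z, hz, rfl⟩ | ⟨z, hz, rfl⟩) <;>
      · simp only [Set.mem_ofPred_eq, Zsqrtd.norm_mul, hπn, hπ'n] at *
        rw [hz]; push_cast; ring
    · intro hw
      simp only [Set.mem_ofPred_eq] at hw
      have key : π ∣ w * star w := by
        rw [← Zsqrtd.norm_eq_mul_conj, hw]
        refine ⟨star π * (p * m), ?_⟩
        rw [← mul_assoc, hππ]; push_cast; ring
      rcases hπ.dvd_or_dvd key with ⟨z, rfl⟩ | ⟨v, hv⟩
      · refine Or.inl ⟨z, ?_, rfl⟩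
        simp only [Set.mem_ofPred_eq, Zsqrtd.norm_mul, hπn] at *
        push_cast at *
        exact mul_left_cancel₀ hp0 (by linear_combination hw)
      · have hw' : w = star π * star v := by
          have := congrArg star hv
          simpa [mul_comm] using this
        subst hw'
        refine Or.inr ⟨star v, ?_, rfl⟩
        simp only [Set.mem_ofPred_eq, Zsqrtd.norm_mul, hπ'n] at *
        push_cast at *
        exact mul_left_cancel₀ hp0 (by linear_combination hw)
  have hB : (π * ·) '' {z : GaussianInt | z.norm = (p * m : ℕ)} ∩
      (star π * ·) '' {z : GaussianInt | z.norm = (p * m : ℕ)} =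
      (fun z => π * (star π * z)) '' {z : GaussianInt | z.norm = m} := by
    ext w
    constructor
    · rintro ⟨⟨z, hz, rfl⟩, ⟨v, hv, hvz⟩⟩
      simp only at hvz
      have : π ∣ star π * v := ⟨z, hvz⟩
      obtain ⟨u, rfl⟩ := (hπ.dvd_or_dvd this).resolve_left hndvd
      have hz' : z = star π * u := by
        refine mul_left_cancel₀ hπ.ne_zero ?_
        rw [← hvz]; ring
      subst hz'
      refine ⟨u, ?_, rfl⟩
      simp only [Set.mem_ofPred_eq, Zsqrtd.norm_mul, hπ'n] at *
      push_cast at *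
      exact mul_left_cancel₀ hp0 hz
    · rintro ⟨u, hu, rfl⟩
      simp only [Set.mem_ofPred_eq] at hu
      refine ⟨⟨star π * u, ?_, rfl⟩, ⟨π * u, ?_, by ring⟩⟩ <;>
      · simp only [Set.mem_ofPred_eq, Zsqrtd.norm_mul, hπn, hπ'n, hu]
        push_cast; ring
  have hinj' : Function.Injective fun z => π * (star π * z) :=
    (hinj π hπ).comp (hinj _ hπ')
  have h := Set.ncard_union_add_ncard_inter
    ((π * ·) '' {z : GaussianInt | z.norm = (p * m : ℕ)})
    ((star π * ·) '' {z : GaussianInt | z.norm = (p * m : ℕ)})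
    ((gaussian_finite _).image _) ((gaussian_finite _).image _)
  rw [hA, hB, Set.ncard_image_of_injective _ (hinj π hπ),
    Set.ncard_image_of_injective _ (hinj _ hπ'), Set.ncard_image_of_injective _ hinj'] at h
  rw [sumTwoSquaresCount, sumTwoSquaresCount, sumTwoSquaresCount, h, two_mul]

/-! ### The congruences for B -/

theorem biregularOverpartitionCount_sq_mul {p : ℕ} (hp : p.Prime) (hp6 : p % 6 = 5) {m : ℕ}
    (hm : m % 6 = 1) :
    (biregularOverpartitionCount 2 9 (p ^ 2 * m) : ℤ) ≡
      -(p : ℤ) * biregularOverpartitionCount 2 9 m [ZMOD 8] := by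
  have hpm : (p * m) % 6 = 5 := by rw [Nat.mul_mod, hp6, hm]
  have hppm : (p ^ 2 * m) % 6 = 1 := by
    rw [pow_two, mul_assoc, Nat.mul_mod, hp6, hpm]
  have h1 := two_mul_biregularOverpartitionCount_modEq hppm
  have h2 := two_mul_biregularOverpartitionCount_modEq hm
  obtain ⟨b, hb⟩ := two_dvd_biregularOverpartitionCount hm
  rw [hb] at h2 ⊢
  rcases (show p % 4 = 1 ∨ p % 4 = 3 by omega) with h4 | h4
  · have h3 := sumTwoSquaresCount_sq_mul_of_split hp h4 m
    have h5 := eight_dvd_sumTwoSquaresCount hpm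
    obtain ⟨t, ht⟩ : ∃ t, p = 4 * t + 1 := ⟨p / 4, by omega⟩
    have e : -(p : ℤ) * (2 * b) = -(2 * b) - 8 * (t * b) := by rw [ht]; push_cast; ring
    rw [e]
    generalize (t : ℤ) * b = c
    simp only [Int.ModEq] at *
    omega
  · rw [sumTwoSquaresCount_sq_mul_of_inert hp h4 m] at h1
    obtain ⟨t, ht⟩ : ∃ t, p = 4 * t + 3 := ⟨p / 4, by omega⟩
    have e : -(p : ℤ) * (2 * b) = 2 * b - 8 * (t * b + b) := by rw [ht]; push_cast; ring
    rw [e]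
    generalize (t : ℤ) * b = c
    simp only [Int.ModEq] at *
    omega

theorem theorem3p4 (p : ℕ) (hp : p.Prime) (hp6 : p ≡ 5 [MOD 6]) :
    (∀ k r n : ℕ, 0 < k → p ∣ 6 * r + 5 →
      (biregularOverpartitionCount 2 9 (6 * p ^ (k + 1) * n + 6 * p * r + 5 * p) : ℤ) ≡
        (-(p : ℤ)) *
          (biregularOverpartitionCount 2 9 (6 * p ^ (k - 1) * n + (6 * r + 5) / p) : ℤ) [ZMOD 8]) ∧
    (∀ k n : ℕ, 0 < k →
      (biregularOverpartitionCount 2 9 (6 * p ^ (2 * k) * n + p ^ (2 * k)) : ℤ) ≡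
        (-(p : ℤ)) ^ k * (biregularOverpartitionCount 2 9 (6 * n + 1) : ℤ) [ZMOD 8]) := by
  have hp6' : p % 6 = 5 := hp6
  refine ⟨fun k r n hk hr => ?_, fun k n _ => ?_⟩
  · obtain ⟨l, rfl⟩ : ∃ l, k = l + 1 := ⟨k - 1, by omega⟩
    obtain ⟨s, hs⟩ := hr
    have hs6 : s % 6 = 1 := by
      have h := congrArg (· % 6) hs
      simp only [Nat.mul_mod p s, hp6'] at h
      have : s % 6 < 6 := Nat.mod_lt _ (by norm_num)
      omega
    rw [hs, Nat.mul_div_cancel_left _ hp.pos, Nat.add_sub_cancel]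
    -- With 6r + 5 = ps, the argument is p² times a number congruent to s ≡ 1 mod 6.
    have e : 6 * p ^ (l + 1 + 1) * n + 6 * p * r + 5 * p = p ^ 2 * (6 * p ^ l * n + s) := by
      have : 6 * p * r + 5 * p = p * (p * s) := by rw [← hs]; ring
      rw [add_assoc, this]; ring
    rw [e]
    refine biregularOverpartitionCount_sq_mul hp hp6' ?_
    rw [mul_assoc]
    omega
  -- Iterate the p² relation, starting from the trivial case k = 0; p^(2k) ≡ 1 mod 6 keeps the
  -- argument in the required class.
  · clear * - hp hp6'
    induction k generalizing n with
    | zero => simp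
    | succ k ih =>
      obtain ⟨t, ht⟩ : ∃ t, p ^ (2 * k) = 6 * t + 1 := by
        have : p ^ (2 * k) % 6 = 1 := by
          rw [pow_mul, Nat.pow_mod, Nat.pow_mod p, hp6']; norm_num
        exact ⟨p ^ (2 * k) / 6, by omega⟩
      have e : 6 * p ^ (2 * (k + 1)) * n + p ^ (2 * (k + 1)) =
          p ^ 2 * (6 * p ^ (2 * k) * n + p ^ (2 * k)) := by ring
      rw [e, pow_succ' (-(p : ℤ)), mul_assoc (-(p : ℤ))]
      refine (biregularOverpartitionCount_sq_mul hp hp6' ?_).trans ((ih n).mul_left _)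
      rw [mul_assoc]
      omega
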